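/- **Setting.** Instances are bit strings $x$, and $L\subseteq\{0,1\}^*$ is a language. All quantum registers are finite-dimensional. A *1-bit-challenge (receive-and-measure) $\Xi$-protocol* $\Pi=(P_1,P_2,V)$ works as follows on instance $x$. The prover, holding a witness state $|w\rangle$, prepares a state $|\varphi\rangle_{AB}$ using an isometry $P_1$, and sends the register $A$. The verifier sends a uniformly random bit $c$ and measures $A$ with a POVM $\{E^x_{c,a}\}_a$ chosen by $c$, getting an outcome $a$. The prover measures its register $B$ according to $P_2$ and $c$, and sends the outcome, a classical response $r\in\{0,1\}^{\ell(x)}$. The verifier accepts iff a predicate $V(x,a,c,r)$ holds. The protocol $\Pi$ is *$\varepsilon$-sound* for $L$ if for every $x\notin L$ and every (unbounded) quantum prover, i.e. every state $\rho_{AB}$ with a register $B$ of arbitrary finite dimension and all POVMs $\{M_{c,r}\}_r$ on $B$ for $c\in\{0,1\}$, $$\frac12\sum_{c}\ \sum_{a,r\,:\,V(x,a,c,r)=1}\operatorname{tr}\big(\rho\,(E^x_{c,a}\otimes M_{c,r})\big)\le\varepsilon .$$ **The compiler.** Let $k,n\ge 0$ be integers and, for each $x$, let $\mathcal H_x$ be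 a universal$_2$ family of hash functions from bit strings of length at most $n$ to $\{0,1\}^{\ell(x)}$. For $s,\theta\in\{0,1\}^n$ write $|s\rangle_\theta=\bigotimes_j H^{\theta_j}|s_j\rangle$ with $H$ the Hadamard transform, and let $s^{c}$ be the substring of $s$ at the positions $j$ with $\theta_j=c$. The one-message protocol $\mathsf{NIP}[\Pi]$ on $x$ is the following; there is no setup. * *Prover.* Independently for each $i\in[k]$: prepare a first message $\varphi_i$ (in register $A_i$) with $P_1$ and compute with $P_2$ the responses $r_i^0,r_i^1$ to both challenges; choose uniformly random $s_i,\theta_i\in\{0,1\}^n$ and $h_i^0,h_i^1\in\mathcal H_x$; put $|s_i\rangle_{\theta_i}$ in register $X_i$ and let $m_i^c=r_i^c\oplus h_i^c(s_i^{c})$ for $c\in\{0,1\}$. Send the quantum registers $A_1X_1\cdots A_kX_k$, followed by the classical data $(\theta_i,h_i^0,h_i^1,m_i^0,m_i^1)_{i\in[k]}$. * *Verifier.* Choose uniformly random bits $c_1,\dots,c_k$. Before receiving the classical data, measure for each $i$ the register $A_i$ with $\{E^x_{c_i,a}\}_a$, getting $a_i$, and all $n$ qubits of $X_i$ in the computational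 basis if $c_i=0$, in the Hadamard basis if $c_i=1$, getting $s_i'$. Let $s_i'^{\,c_i}$ be the substring of $s_i'$ at the positions $j$ with $(\theta_i)_j=c_i$, and put $r_i=m_i^{c_i}\oplus h_i^{c_i}(s_i'^{\,c_i})$. Accept iff $V(x,a_i,c_i,r_i)=1$ for all $i\in[k]$. **Theorem.** Let $\Pi$ be a 1-bit-challenge receive-and-measure $\Xi$-protocol that is $\tfrac12$-sound for $L$ against quantum provers. Then $\mathsf{NIP}[\Pi]$ is sound with soundness error $2^{-k}$: for every $x\notin L$ and every malicious prover, unbounded in computation and memory, i.e. every joint state of the quantum registers $A_1X_1\cdots A_kX_k$ and the classical data (possibly entangled across the copies and correlated with the classical data), the verifier accepts with probability at most $2^{-k}$. -/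

import Mathlib

open scoped BigOperators Matrix ComplexOrder Kronecker

noncomputable section

/-! ### Finite-dimensional quantum mechanics -/

/-- Bit strings of length `m`; they also label the computational basis of `m` qubits. -/
abbrev Bits (m : ℕ) : Type := Fin m → Bool

/-- A measurement (POVM) with outcomes in `O` on a register with computational basis `Q`. -/
structure POVM (Q O : Type) [Fintype Q] [DecidableEq Q] [Fintype O] where
  elem : O → Matrix Q Q ℂ
  psd : ∀ o, (elem o).PosSemidef
  sum_elem : ∑ o, elem o = 1

/-- A (mixed) state of a register with computational basis `Q`. -/
structure DensityOp (Q : Type) [Fintype Q] where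
  op : Matrix Q Q ℂ
  psd : op.PosSemidef
  trace_op : op.trace = 1

/-- A joint state of a quantum register `Q` and a classical register `T`:
the state is `∑ t, ρ t ⊗ |t⟩⟨t|`, so that `tr (ρ t)` is the probability of the classical value `t`
and `ρ t` is the corresponding unnormalised state of `Q`. -/
structure CQState (Q T : Type) [Fintype Q] [Fintype T] where
  op : T → Matrix Q Q ℂ
  psd : ∀ t, (op t).PosSemidef
  trace_op : ∑ t, (op t).trace = 1

/-- The tensor product `M 0 ⊗ ⋯ ⊗ M (k-1)` of operators on `k` registers. -/
def tensorAll {k : ℕ} {Q R : Type} (M : Fin k → Matrix Q R ℂ) :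
    Matrix (Fin k → Q) (Fin k → R) ℂ :=
  Matrix.of fun u v => ∏ i, M i (u i) (v i)

/-- The rank-one operator `|v⟩⟨v|`. -/
def ketbra {Q : Type} (v : Q → ℂ) : Matrix Q Q ℂ := Matrix.vecMulVec v (star v)

theorem ketbra_psd {Q : Type} [Fintype Q] (v : Q → ℂ) : (ketbra v).PosSemidef :=
  Matrix.posSemidef_vecMulVec_self_star v

theorem tensorAll_mul {k : ℕ} {Q R S : Type} [Fintype R]
    (M : Fin k → Matrix Q R ℂ) (N : Fin k → Matrix R S ℂ) :
    tensorAll M * tensorAll N = tensorAll fun i => M i * N i := by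
  ext u v
  simp only [tensorAll, Matrix.mul_apply, Matrix.of_apply, ← Finset.prod_mul_distrib]
  rw [Finset.prod_univ_sum, Fintype.piFinset_univ]

open scoped MatrixOrder in
theorem tensorAll_psd {k : ℕ} {Q : Type} [Fintype Q] {M : Fin k → Matrix Q Q ℂ}
    (h : ∀ i, (M i).PosSemidef) : (tensorAll M).PosSemidef := by
  classical
  have hex : ∀ i, ∃ B : Matrix Q Q ℂ, M i = Bᴴ * B := fun i =>
    CStarAlgebra.nonneg_iff_eq_star_mul_self.1 (Matrix.nonneg_iff_posSemidef.2 (h i))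
  choose B hB using hex
  have h1 : tensorAll M = (tensorAll B)ᴴ * tensorAll B := by
    have h2 : (tensorAll B)ᴴ = tensorAll fun i => (B i)ᴴ := by
      ext u v
      simp [tensorAll, Matrix.conjTranspose_apply]
    rw [h2, tensorAll_mul]
    congr 1
    funext i
    exact hB i
  rw [h1]
  exact Matrix.posSemidef_conjTranspose_mul_self _

theorem tensorAll_trace {k : ℕ} {Q : Type} [Fintype Q] (M : Fin k → Matrix Q Q ℂ) :
    (tensorAll M).trace = ∏ i, (M i).trace := by
  simp only [tensorAll, Matrix.trace, Matrix.diag, Matrix.of_apply]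
  rw [Finset.prod_univ_sum, Fintype.piFinset_univ]

theorem tensorAll_one {k : ℕ} {Q : Type} [DecidableEq Q] :
    tensorAll (fun _ : Fin k => (1 : Matrix Q Q ℂ)) = 1 := by
  ext u v
  simp only [tensorAll, Matrix.of_apply, Matrix.one_apply]
  by_cases h : u = v
  · simp [h]
  · obtain ⟨i, hi⟩ := Function.ne_iff.1 h
    rw [if_neg h]
    exact Finset.prod_eq_zero (Finset.mem_univ i) (if_neg hi)

theorem tensorAll_sum {k : ℕ} {Q O : Type} [Fintype O] (E : Fin k → O → Matrix Q Q ℂ) :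
    ∑ o : Fin k → O, tensorAll (fun i => E i (o i)) = tensorAll fun i => ∑ a, E i a := by
  ext u v
  simp only [tensorAll, Matrix.sum_apply, Matrix.of_apply]
  rw [Finset.prod_univ_sum, Fintype.piFinset_univ]

namespace POVM

variable {Q Q' O O' : Type} [Fintype Q] [DecidableEq Q] [Fintype Q'] [DecidableEq Q']
  [Fintype O] [Fintype O']

/-- Measuring two registers separately. -/
def prod (E : POVM Q O) (F : POVM Q' O') : POVM (Q × Q') (O × O') where
  elem o := E.elem o.1 ⊗ₖ F.elem o.2
  psd o := (E.psd o.1).kronecker (F.psd o.2)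
  sum_elem := by
    have h : ∑ o : O × O', E.elem o.1 ⊗ₖ F.elem o.2 = (∑ a, E.elem a) ⊗ₖ (∑ b, F.elem b) := by
      ext u v
      simp only [Matrix.sum_apply, Matrix.kroneckerMap_apply, Fintype.sum_prod_type,
        Finset.sum_mul_sum]
    rw [h, E.sum_elem, F.sum_elem, Matrix.one_kronecker_one]

/-- Measuring `k` registers separately. -/
def pi {k : ℕ} (E : Fin k → POVM Q O) : POVM (Fin k → Q) (Fin k → O) where
  elem o := tensorAll fun i => (E i).elem (o i)
  psd o := tensorAll_psd fun i => (E i).psd (o i)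
  sum_elem := by
    rw [tensorAll_sum fun i => (E i).elem]
    simp only [POVM.sum_elem]
    exact tensorAll_one

end POVM

/-! ### BB84 states -/

/-- The amplitude `⟨y| H^θ |x⟩` for single bits, where `H` is the Hadamard transform. -/
def hadamardAmp (θ y x : Bool) : ℂ :=
  if θ then (if x && y then -1 else 1) / (Real.sqrt 2 : ℂ) else if y = x then 1 else 0

/-- The BB84 state `|x⟩_θ = ⨂ⱼ H^{θⱼ} |xⱼ⟩`. The bit `false` stands for the computational basis
`+`, the bit `true` for the Hadamard basis `×`. -/
def bb84 {n : ℕ} (θ x : Bits n) : Bits n → ℂ := fun y => ∏ j, hadamardAmp (θ j) (y j) (x j)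

theorem sqrt_two_mul_self_complex : (Real.sqrt 2 : ℂ) * (Real.sqrt 2 : ℂ) = 2 := by
  rw [← Complex.ofReal_mul, Real.mul_self_sqrt (by norm_num)]
  norm_num

theorem hadamardAmp_complete (θ y z : Bool) :
    ∑ x, hadamardAmp θ y x * star (hadamardAmp θ z x) = if y = z then 1 else 0 := by
  have h2 := sqrt_two_mul_self_complex
  have h0 : (Real.sqrt 2 : ℂ) ≠ 0 := by
    intro h
    rw [h] at h2
    norm_num at h2
  cases θ <;> cases y <;> cases z <;> simp [hadamardAmp] <;> field_simp <;>
    norm_num [pow_two, h2]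

theorem hadamardAmp_unit (θ x : Bool) :
    ∑ y, hadamardAmp θ y x * star (hadamardAmp θ y x) = 1 := by
  have h2 := sqrt_two_mul_self_complex
  have h0 : (Real.sqrt 2 : ℂ) ≠ 0 := by
    intro h
    rw [h] at h2
    norm_num at h2
  cases θ <;> cases x <;> simp [hadamardAmp] <;> field_simp <;>
    norm_num [pow_two, h2]

theorem bb84_trace {n : ℕ} (θ x : Bits n) : (ketbra (bb84 θ x)).trace = 1 := by
  simp only [ketbra, bb84, Matrix.trace, Matrix.diag, Matrix.vecMulVec_apply, Pi.star_apply,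
    star_prod, ← Finset.prod_mul_distrib]
  rw [← Fintype.piFinset_univ,
    ← Finset.prod_univ_sum (fun _ => Finset.univ)
      fun j y => hadamardAmp (θ j) y (x j) * star (hadamardAmp (θ j) y (x j))]
  simp only [hadamardAmp_unit, Finset.prod_const_one]

/-- Measuring qubit number `j` in the basis `+` or `×` according to `θ j`, for all `j`. -/
def bb84Meas {n : ℕ} (θ : Bits n) : POVM (Bits n) (Bits n) where
  elem x := ketbra (bb84 θ x)
  psd x := ketbra_psd _
  sum_elem := by
    ext u v
    simp only [ketbra, bb84, Matrix.sum_apply, Matrix.vecMulVec_apply, Pi.star_apply,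
      star_prod, ← Finset.prod_mul_distrib]
    rw [← Fintype.piFinset_univ,
      ← Finset.prod_univ_sum (fun _ => Finset.univ)
        fun j x => hadamardAmp (θ j) (u j) x * star (hadamardAmp (θ j) (v j) x)]
    simp only [hadamardAmp_complete, Matrix.one_apply]
    by_cases h : u = v
    · simp [h]
    · obtain ⟨i, hi⟩ := Function.ne_iff.1 h
      rw [if_neg h]
      exact Finset.prod_eq_zero (Finset.mem_univ i) (if_neg hi)

/-! ### Three-message protocols with a one-bit challenge -/

/-- A 1-bit-challenge `Ξ`-protocol whose verifier is receive-and-measure; instances are bit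
strings `x`.

* The prover, on a witness state `|w⟩`, prepares `|φ⟩_{AB} = P₁ |w⟩` with an isometry `P₁` and
  sends register `A`.
* The verifier sends a uniformly random challenge `c`, and measures `A` with a measurement chosen
  by `c`, obtaining an outcome `a`.
* The prover computes its classical response `r` by measuring its register `B`; the measurement
  is given by the measurement operators `P₂ c r` (the state changes to `P₂ c r |·⟩`).
* The verifier accepts iff `pred a c r` is true. -/
structure XiProtocol where
  witQubits : List Bool → ℕ
  msgQubits : List Bool → ℕ
  privQubits : List Bool → ℕ
  respLen : List Bool → ℕ
  outLen : List Bool → ℕ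
  prover₁ : ∀ x, Matrix (Bits (msgQubits x) × Bits (privQubits x)) (Bits (witQubits x)) ℂ
  prover₁_isometry : ∀ x, (prover₁ x)ᴴ * prover₁ x = 1
  prover₂ : ∀ x, Bool → Bits (respLen x) →
    Matrix (Bits (privQubits x)) (Bits (privQubits x)) ℂ
  prover₂_complete : ∀ x c, ∑ r, (prover₂ x c r)ᴴ * prover₂ x c r = 1
  meas : ∀ x, Bool → POVM (Bits (msgQubits x)) (Bits (outLen x))
  pred : ∀ x, Bits (outLen x) → Bool → Bits (respLen x) → Bool

/-- A (malicious, computationally and memory unbounded) prover strategy in the interactive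
protocol: a joint state of the first message `A` and of a private register `B` of arbitrary finite
dimension, and for each challenge a measurement of `B` giving the response. -/
structure InteractiveProver (A R : Type) [Fintype A] [DecidableEq A] [Fintype R] where
  B : Type
  [fintypeB : Fintype B]
  [decEqB : DecidableEq B]
  state : DensityOp (A × B)
  respond : Bool → POVM B R

attribute [instance] InteractiveProver.fintypeB InteractiveProver.decEqB

namespace XiProtocol

/-- The probability that the verifier of `P` accepts on instance `x`, interacting with `S`. -/
def acceptProb (P : XiProtocol) (x : List Bool)
    (S : InteractiveProver (Bits (P.msgQubits x)) (Bits (P.respLen x))) : ℝ :=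
  (1 / 2) * ∑ c : Bool, ∑ a, ∑ r,
    if P.pred x a c r then
      (S.state.op * ((P.meas x c).elem a ⊗ₖ (S.respond c).elem r)).trace.re
    else 0

/-- `P` is `ε`-sound for the language `L`, against all quantum provers. -/
def IsSound (P : XiProtocol) (L : Language Bool) (ε : ℝ) : Prop :=
  ∀ x, x ∉ L → ∀ S, P.acceptProb x S ≤ ε

end XiProtocol

/-! ### One-message protocols -/

/-- A one-message proof (for one fixed instance): without any setup, the prover sends a quantum
register `Q` and a classical message in `T`. The verifier draws `coin` uniformly at random,
measures `Q` with a measurement depending on `coin` only (thus before it gets the classical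
message, so it needs no quantum memory), and finally decides from its coins, its measurement
outcome, and the classical message. -/
structure OneMessageProof (W Q T C O : Type) [Fintype Q] [DecidableEq Q] [Fintype T] [Fintype C]
    [Fintype O] where
  honest : W → CQState Q T
  meas : C → POVM Q O
  decision : C → O → T → Prop

namespace OneMessageProof

open scoped Classical in
/-- The probability that the verifier accepts the message `ρ`. -/
def acceptProb {W Q T C O : Type} [Fintype Q] [DecidableEq Q] [Fintype T] [Fintype C] [Fintype O]
    (P : OneMessageProof W Q T C O) (ρ : CQState Q T) : ℝ :=
  (Fintype.card C : ℝ)⁻¹ * ∑ c, ∑ t, ∑ o,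
    if P.decision c o t then (ρ.op t * (P.meas c).elem o).trace.re else 0

/-- A family of one-message proofs, indexed by the instances, is `ε`-sound for `L`: on a
no-instance, whatever prover (without any bound on its time or memory) prepared the message,
i.e. for every joint state of the quantum and classical parts of the message, the verifier accepts
with probability at most `ε`. -/
def IsSound {W Q T C O : List Bool → Type} [∀ x, Fintype (Q x)] [∀ x, DecidableEq (Q x)]
    [∀ x, Fintype (T x)] [∀ x, Fintype (C x)] [∀ x, Fintype (O x)]
    (P : ∀ x, OneMessageProof (W x) (Q x) (T x) (C x) (O x)) (L : Language Bool) (ε : ℝ) : Prop :=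
  ∀ x, x ∉ L → ∀ ρ : CQState (Q x) (T x), (P x).acceptProb ρ ≤ ε

end OneMessageProof

/-! ### The compiler -/

/-- A universal₂ family of hash functions from strings of length at most `n` to `ℓ` bits. -/
structure UniversalHash (n ℓ : ℕ) where
  Key : Type
  [fintypeKey : Fintype Key]
  [nonemptyKey : Nonempty Key]
  eval : Key → List Bool → Bits ℓ
  universal : ∀ u v : List Bool, u ≠ v → u.length = v.length → u.length ≤ n →
    (Finset.univ.filter fun h => eval h u = eval h v).card * 2 ^ ℓ ≤ Fintype.card Key

attribute [instance] UniversalHash.fintypeKey UniversalHash.nonemptyKey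

/-- The substring of `x` at the positions `j` with `θ j = c`. -/
def substring {n : ℕ} (θ : Bits n) (c : Bool) (x : Bits n) : List Bool :=
  ((List.finRange n).filter fun j => θ j == c).map x

/-- Bitwise exclusive or. -/
def xorBits {ℓ : ℕ} (a b : Bits ℓ) : Bits ℓ := fun j => xor (a j) (b j)

/-- The classical part `(θ, (h⁰, h¹), (m⁰, m¹))` of an oblivious transfer. -/
abbrev OTMsg {n ℓ : ℕ} (H : UniversalHash n ℓ) : Type :=
  Bits n × (Bool → H.Key) × (Bool → Bits ℓ)

/-- The masked inputs `m^c = r^c ⊕ h^c(x^c)` of the oblivious transfer sender. -/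
def otMask {n ℓ : ℕ} (H : UniversalHash n ℓ) (θ : Bits n) (h : Bool → H.Key) (x : Bits n)
    (r : Bool → Bits ℓ) : Bool → Bits ℓ :=
  fun c => xorBits (r c) (H.eval (h c) (substring θ c x))

/-- What a receiver with choice bit `c` and measurement result `x'` outputs:
`m^c ⊕ h^c(x'^c)`. -/
def otOutput {n ℓ : ℕ} (H : UniversalHash n ℓ) (t : OTMsg H) (c : Bool) (x' : Bits n) : Bits ℓ :=
  xorBits (t.2.2 c) (H.eval (t.2.1 c) (substring t.1 c x'))

namespace XiProtocol

/-- A pure witness state. -/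
structure Witness (P : XiProtocol) (x : List Bool) where
  vec : Bits (P.witQubits x) → ℂ
  unit : star vec ⬝ᵥ vec = 1

/-- The joint unnormalised vector on `AB` after the honest prover has prepared `P₁ |w⟩` and has
computed from `B` the response `r 0` to challenge `0` and then the response `r 1` to
challenge `1`. -/
def bothResponses (P : XiProtocol) (x : List Bool) (w : P.Witness x)
    (r : Bool → Bits (P.respLen x)) : Bits (P.msgQubits x) × Bits (P.privQubits x) → ℂ :=
  (((1 : Matrix (Bits (P.msgQubits x)) (Bits (P.msgQubits x)) ℂ) ⊗ₖ
    (P.prover₂ x true (r true) * P.prover₂ x false (r false))) * P.prover₁ x) *ᵥ w.vec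

/-- The corresponding unnormalised state of `A` (the partial trace over `B`). -/
def firstMessage (P : XiProtocol) (x : List Bool) (w : P.Witness x)
    (r : Bool → Bits (P.respLen x)) :
    Matrix (Bits (P.msgQubits x)) (Bits (P.msgQubits x)) ℂ :=
  ∑ b, ketbra fun a => P.bothResponses x w r (a, b)

/-- The honest prover's message in one copy, as an unnormalised state of the quantum registers
`A` and `X` for each value of the classical message `(θ, h, m)`: `θ`, the string `s` encoded in
`X`, and the two hash functions are uniformly random. -/
def copyState (P : XiProtocol) {n : ℕ} (x : List Bool) (H : UniversalHash n (P.respLen x))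
    (w : P.Witness x) (t : OTMsg H) :
    Matrix (Bits (P.msgQubits x) × Bits n) (Bits (P.msgQubits x) × Bits n) ℂ :=
  (Fintype.card (Bits n × (Bool → H.Key) × Bits n) : ℂ)⁻¹ •
    ∑ s : Bits n, ∑ r : Bool → Bits (P.respLen x),
      if t.2.2 = otMask H t.1 t.2.1 s r then P.firstMessage x w r ⊗ₖ ketbra (bb84 t.1 s) else 0

theorem firstMessage_psd (P : XiProtocol) (x : List Bool) (w : P.Witness x)
    (r : Bool → Bits (P.respLen x)) : (P.firstMessage x w r).PosSemidef :=
  Matrix.posSemidef_sum _ fun _ _ => ketbra_psd _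

theorem copyState_psd (P : XiProtocol) {n : ℕ} (x : List Bool)
    (H : UniversalHash n (P.respLen x)) (w : P.Witness x) (t : OTMsg H) :
    (P.copyState x H w t).PosSemidef := by
  unfold copyState
  refine Matrix.PosSemidef.smul ?_ ?_
  · refine Matrix.posSemidef_sum _ fun s _ => Matrix.posSemidef_sum _ fun r _ => ?_
    split_ifs
    · exact (P.firstMessage_psd x w r).kronecker (ketbra_psd _)
    · exact Matrix.PosSemidef.zero
  · have h : ((Fintype.card (Bits n × (Bool → H.Key) × Bits n) : ℂ))⁻¹ =
        (((Fintype.card (Bits n × (Bool → H.Key) × Bits n) : ℝ)⁻¹ : ℝ) : ℂ) := by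
      push_cast
      rfl
    rw [h]
    exact Complex.zero_le_real.2 (by positivity)

theorem sum_measured {W A B R : Type} [Fintype W] [DecidableEq W] [Fintype A] [DecidableEq A]
    [Fintype B] [DecidableEq B] [Fintype R] (U : Matrix (A × B) W ℂ) (hU : Uᴴ * U = 1)
    (K : R → Matrix B B ℂ) (hK : ∑ r, (K r)ᴴ * K r = 1) (w : W → ℂ) (hw : star w ⬝ᵥ w = 1) :
    ∑ r, star ((Matrix.kronecker (1 : Matrix A A ℂ) (K r) * U) *ᵥ w) ⬝ᵥ
      ((Matrix.kronecker (1 : Matrix A A ℂ) (K r) * U) *ᵥ w) = 1 := by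
  have h2 : ∀ r, star ((Matrix.kronecker (1 : Matrix A A ℂ) (K r) * U) *ᵥ w) ⬝ᵥ
      ((Matrix.kronecker (1 : Matrix A A ℂ) (K r) * U) *ᵥ w) =
      star w ⬝ᵥ ((Uᴴ * (Matrix.kronecker (1 : Matrix A A ℂ) ((K r)ᴴ * K r) * U)) *ᵥ w) := by
    intro r
    have h3 : Matrix.kronecker (1 : Matrix A A ℂ) ((K r)ᴴ * K r) =
        (Matrix.kronecker (1 : Matrix A A ℂ) (K r))ᴴ * Matrix.kronecker (1 : Matrix A A ℂ) (K r) := by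
      simp only [Matrix.kronecker]
      rw [Matrix.conjTranspose_kronecker,
        Matrix.conjTranspose_one, ← Matrix.mul_kronecker_mul, Matrix.one_mul]
    rw [h3, Matrix.star_mulVec, ← Matrix.dotProduct_mulVec, Matrix.mulVec_mulVec,
      Matrix.conjTranspose_mul]
    simp only [Matrix.mul_assoc]
  have h4 : ∑ r, Matrix.kronecker (1 : Matrix A A ℂ) ((K r)ᴴ * K r) = 1 := by
    have h5 : ∑ r, Matrix.kronecker (1 : Matrix A A ℂ) ((K r)ᴴ * K r) =
        Matrix.kronecker (1 : Matrix A A ℂ) (∑ r, (K r)ᴴ * K r) := by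
      ext u v
      simp only [Matrix.sum_apply, Matrix.kronecker, Matrix.kroneckerMap_apply, Finset.mul_sum]
    rw [h5, hK]
    exact Matrix.one_kronecker_one
  simp only [h2]
  rw [← dotProduct_sum, ← Matrix.sum_mulVec, ← Matrix.mul_sum, ← Matrix.sum_mul, h4,
    Matrix.one_mul, hU, Matrix.one_mulVec, hw]

theorem firstMessage_trace (P : XiProtocol) (x : List Bool) (w : P.Witness x) :
    ∑ r, (P.firstMessage x w r).trace = 1 := by
  let K : (Bool → Bits (P.respLen x)) → Matrix _ _ ℂ := fun r =>
    P.prover₂ x true (r true) * P.prover₂ x false (r false)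
  have hK : ∑ r, (K r)ᴴ * K r = 1 := by
    rw [← (Equiv.boolArrowEquivProd _).symm.sum_comp, Fintype.sum_prod_type]
    have h : ∀ a b, (K ((Equiv.boolArrowEquivProd _).symm (a, b)))ᴴ *
        K ((Equiv.boolArrowEquivProd _).symm (a, b)) =
        (P.prover₂ x false a)ᴴ * (((P.prover₂ x true b)ᴴ * P.prover₂ x true b) *
          P.prover₂ x false a) := by
      intro a b
      simp only [K, Equiv.boolArrowEquivProd, Equiv.coe_fn_symm_mk, Matrix.conjTranspose_mul,
        Matrix.mul_assoc, if_true, Bool.false_eq_true, if_false]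
    simp only [h, ← Finset.mul_sum, ← Finset.sum_mul, P.prover₂_complete, Matrix.one_mul]
  have h1 : ∀ r, (P.firstMessage x w r).trace =
      star (P.bothResponses x w r) ⬝ᵥ P.bothResponses x w r := by
    intro r
    simp only [firstMessage, ketbra, Matrix.trace_sum, Matrix.trace_vecMulVec, dotProduct,
      Pi.star_apply, Fintype.sum_prod_type]
    rw [Finset.sum_comm]
    exact Finset.sum_congr rfl fun a _ => Finset.sum_congr rfl fun b _ => mul_comm _ _
  simp only [h1]
  exact sum_measured (P.prover₁ x) (P.prover₁_isometry x) K hK w.vec w.unit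

theorem copyState_trace (P : XiProtocol) {n : ℕ} (x : List Bool)
    (H : UniversalHash n (P.respLen x)) (w : P.Witness x) :
    ∑ t, (P.copyState x H w t).trace = 1 := by
  have h : ∀ t : OTMsg H, (P.copyState x H w t).trace =
      (Fintype.card (Bits n × (Bool → H.Key) × Bits n) : ℂ)⁻¹ *
        ∑ s : Bits n, ∑ r : Bool → Bits (P.respLen x),
          if t.2.2 = otMask H t.1 t.2.1 s r then (P.firstMessage x w r).trace else 0 := by
    intro t
    simp only [copyState, Matrix.trace_smul, Matrix.trace_sum, smul_eq_mul]
    congr 1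
    refine Finset.sum_congr rfl fun s _ => Finset.sum_congr rfl fun r _ => ?_
    split_ifs
    · rw [Matrix.trace_kronecker, bb84_trace, mul_one]
    · exact Matrix.trace_zero _ _
  simp only [h, ← Finset.mul_sum]
  have h2 : ∑ t : OTMsg H, ∑ s : Bits n, ∑ r : Bool → Bits (P.respLen x),
      (if t.2.2 = otMask H t.1 t.2.1 s r then (P.firstMessage x w r).trace else 0) =
      (Fintype.card (Bits n × (Bool → H.Key) × Bits n) : ℂ) := by
    simp only [Fintype.sum_prod_type]
    have h3 : ∀ (θ : Bits n) (g : Bool → H.Key), ∑ m : Bool → Bits (P.respLen x), ∑ s : Bits n,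
        ∑ r : Bool → Bits (P.respLen x),
        (if m = otMask H θ g s r then (P.firstMessage x w r).trace else 0) =
        (Fintype.card (Bits n) : ℂ) := by
      intro θ g
      rw [Finset.sum_comm]
      have h4 : ∀ s : Bits n, ∑ m : Bool → Bits (P.respLen x), ∑ r : Bool → Bits (P.respLen x),
          (if m = otMask H θ g s r then (P.firstMessage x w r).trace else 0) = 1 := by
        intro s
        rw [Finset.sum_comm]
        simp only [Finset.sum_ite_eq', Finset.mem_univ, if_true]
        exact P.firstMessage_trace x w
      simp [h4]
    simp only [h3, Finset.sum_const, Finset.card_univ, nsmul_eq_mul, Fintype.card_prod,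
      Nat.cast_mul]
  rw [h2]
  exact inv_mul_cancel₀ (Nat.cast_ne_zero.2 Fintype.card_ne_zero)

/-- The compiled protocol on instance `x`, with `k` copies of `P` and `n`-qubit oblivious
transfers. In copy `i` the prover sends the quantum registers `Aᵢ` (the first message of `P`) and
`Xᵢ` (a BB84 state), and the classical message `(θᵢ, hᵢ, mᵢ)`. The verifier's coins are the
selection bits `cᵢ`; it measures `Aᵢ` as the verifier of `P` does on challenge `cᵢ` and all of `Xᵢ`
in basis `cᵢ`, recovers the response to `cᵢ`, and accepts iff all copies accept. -/
def NIP (P : XiProtocol) {n : ℕ} (H : ∀ x, UniversalHash n (P.respLen x)) (k : ℕ)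
    (x : List Bool) :
    OneMessageProof (P.Witness x) (Fin k → Bits (P.msgQubits x) × Bits n) (Fin k → OTMsg (H x))
      (Bits k) (Fin k → Bits (P.outLen x) × Bits n) where
  honest w :=
    { op := fun t => tensorAll fun i => P.copyState x (H x) w (t i)
      psd := fun t => tensorAll_psd fun i => P.copyState_psd x (H x) w (t i)
      trace_op := by
        simp only [tensorAll_trace]
        rw [← Fintype.piFinset_univ,
          ← Finset.prod_univ_sum (fun _ => Finset.univ)
            fun _ t => (P.copyState x (H x) w t).trace]
        simp only [copyState_trace, Finset.prod_const_one] }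
  meas c := POVM.pi fun i => (P.meas x (c i)).prod (bb84Meas fun _ => c i)
  decision c o t := ∀ i, P.pred x (o i).1 (c i) (otOutput (H x) (t i) (c i) (o i).2) = true

end XiProtocol

end

/-!
For each value `t` of the classical message and each coin `c`, acceptance in a one-message proof is
a single event of the verifier's measurement, so averaging over `c` gives a positive operator
`acceptOp t` with acceptance probability `∑ t, tr (ρ t * acceptOp t)`. Soundness error `ε` thus
means `acceptOp t ≤ ε • 1` for all `t`. In a parallel repetition `acceptOp` is a tensor product, and
the tensor product is monotone on positive operators, so the soundness error of `k` copies is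
`ε ^ k`. A single copy of the compiled protocol inherits its soundness from the interactive one: a
cheating prover may keep the register `X` as its private register and, on challenge `c`, measure it
in basis `c` and unmask the response, as the verifier would have done.
-/

noncomputable section

open scoped MatrixOrder

section PositiveOperators

variable {𝕜 Q : Type*} [RCLike 𝕜] [Fintype Q]

theorem trace_mul_nonneg {A B : Matrix Q Q 𝕜} (hA : 0 ≤ A) (hB : 0 ≤ B) :
    0 ≤ (A * B).trace := by
  classical
  obtain ⟨C, rfl⟩ := CStarAlgebra.nonneg_iff_eq_star_mul_self.1 hA
  rw [Matrix.star_eq_conjTranspose, Matrix.mul_assoc, Matrix.trace_mul_comm]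
  exact ((Matrix.nonneg_iff_posSemidef.1 hB).mul_mul_conjTranspose_same C).trace_nonneg

theorem trace_mul_le_trace_mul {ρ A B : Matrix Q Q 𝕜} (hρ : 0 ≤ ρ) (hAB : A ≤ B) :
    (ρ * A).trace ≤ (ρ * B).trace := by
  rw [← sub_nonneg, ← Matrix.trace_sub, ← Matrix.mul_sub]
  exact trace_mul_nonneg hρ (sub_nonneg.2 hAB)

end PositiveOperators

/-- The pure state `|v⟩⟨v|` of a unit vector `v`. -/
def DensityOp.ofUnitVec {Q : Type} [Fintype Q] (v : Q → ℂ) (hv : star v ⬝ᵥ v = 1) :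
    DensityOp Q where
  op := ketbra v
  psd := ketbra_psd v
  trace_op := by rw [ketbra, Matrix.trace_vecMulVec, dotProduct_comm, hv]

theorem trace_ketbra_mul {Q : Type} [Fintype Q] (v : Q → ℂ) (M : Matrix Q Q ℂ) :
    (ketbra v * M).trace = star v ⬝ᵥ M *ᵥ v := by
  rw [Matrix.trace_mul_comm, ketbra, Matrix.mul_vecMulVec, Matrix.trace_vecMulVec, dotProduct_comm]

theorem le_smul_one_iff_forall_trace_le {Q : Type} [Fintype Q] [DecidableEq Q] {S : Matrix Q Q ℂ}
    (hS : S.IsHermitian) {ε : ℝ} :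
    S ≤ ε • 1 ↔ ∀ σ : DensityOp Q, (σ.op * S).trace.re ≤ ε := by
  constructor
  · intro h σ
    have hle := trace_mul_le_trace_mul (Matrix.nonneg_iff_posSemidef.2 σ.psd) h
    simpa [σ.trace_op] using (Complex.le_def.1 hle).1
  · intro h
    have hHerm : (ε • (1 : Matrix Q Q ℂ) - S).IsHermitian :=
      (Matrix.isHermitian_one.smul (IsSelfAdjoint.all ε)).sub hS
    rw [Matrix.le_iff, hHerm.posSemidef_iff_eigenvalues_nonneg]
    intro i
    set v : Q → ℂ := ⇑(hHerm.eigenvectorBasis i) with hv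
    have hunit : star v ⬝ᵥ v = 1 := by
      rw [dotProduct_comm, ← EuclideanSpace.inner_eq_star_dotProduct, inner_self_eq_norm_sq_to_K,
        hHerm.eigenvectorBasis.orthonormal.1 i]
      simp
    have hexp := h (DensityOp.ofUnitVec v hunit)
    rw [DensityOp.ofUnitVec, trace_ketbra_mul] at hexp
    rw [hHerm.eigenvalues_eq, ← hv, Matrix.sub_mulVec, Matrix.smul_mulVec, Matrix.one_mulVec,
      dotProduct_sub, dotProduct_smul, hunit]
    simpa using hexp

section TensorProduct

variable {k : ℕ} {Q R : Type}

theorem tensorAll_smul {A : Type*} [CommSemiring A] [Algebra A ℂ] (a : Fin k → A)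
    (M : Fin k → Matrix Q R ℂ) :
    tensorAll (fun i => a i • M i) = (∏ i, a i) • tensorAll M := by
  ext u v
  simp [tensorAll, Algebra.smul_def, Finset.prod_mul_distrib]

theorem tensorAll_eq_zero {M : Fin k → Matrix Q R ℂ} {i : Fin k} (hi : M i = 0) :
    tensorAll M = 0 := by
  ext u v
  exact Finset.prod_eq_zero (Finset.mem_univ i) (by simp [hi])

theorem tensorAll_mono [Finite Q] {A B : Fin k → Matrix Q Q ℂ} (hA : ∀ i, 0 ≤ A i)
    (hAB : ∀ i, A i ≤ B i) : tensorAll A ≤ tensorAll B := by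
  have := Fintype.ofFinite Q
  -- Expanding `⨂ᵢ (A i + (B i - A i))` gives a sum of positive terms, one of which is `⨂ᵢ A i`.
  let E (i : Fin k) (b : Bool) : Matrix Q Q ℂ := if b then A i else B i - A i
  have hE (i b) : 0 ≤ E i b := by
    cases b
    exacts [sub_nonneg.2 (hAB i), hA i]
  have hpos (o : Fin k → Bool) : 0 ≤ tensorAll fun i => E i (o i) :=
    Matrix.nonneg_iff_posSemidef.2 <|
      tensorAll_psd fun i => Matrix.nonneg_iff_posSemidef.1 (hE i (o i))
  calc
    tensorAll A = tensorAll fun i => E i true := rfl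
    _ ≤ ∑ o : Fin k → Bool, tensorAll fun i => E i (o i) :=
      Finset.single_le_sum (f := fun o : Fin k → Bool => tensorAll fun i => E i (o i))
        (fun o _ => hpos o) (Finset.mem_univ fun _ => true)
    _ = tensorAll B := by
      rw [tensorAll_sum]
      simp [E]

theorem tensorAll_le_pow_smul_one [Finite Q] [DecidableEq Q] {A : Fin k → Matrix Q Q ℂ} {ε : ℝ}
    (hA : ∀ i, 0 ≤ A i) (hAε : ∀ i, A i ≤ ε • 1) : tensorAll A ≤ ε ^ k • 1 :=
  (tensorAll_mono hA hAε).trans_eq <| by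
    rw [tensorAll_smul, tensorAll_one, Fin.prod_const]

end TensorProduct

namespace POVM

variable {Q Q' O O' R : Type} [Fintype Q] [DecidableEq Q] [Fintype Q'] [DecidableEq Q']
  [Fintype O] [Fintype O'] [Fintype R]

open scoped Classical in
/-- The operator of the event that the outcome of `E` satisfies `p`: in the state `ρ` this event
has probability `tr (ρ * E.effect p)`. -/
def effect (E : POVM Q O) (p : O → Prop) : Matrix Q Q ℂ := ∑ o with p o, E.elem o

theorem effect_nonneg (E : POVM Q O) (p : O → Prop) : 0 ≤ E.effect p :=
  Finset.sum_nonneg fun o _ => Matrix.nonneg_iff_posSemidef.2 (E.psd o)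

theorem trace_mul_effect_re (E : POVM Q O) (p : O → Prop) [DecidablePred p] (ρ : Matrix Q Q ℂ) :
    (ρ * E.effect p).trace.re = ∑ o, if p o then (ρ * E.elem o).trace.re else 0 := by
  rw [effect, Matrix.mul_sum, Matrix.trace_sum, Complex.re_sum, ← Finset.sum_filter]
  congr!

/-- The measurement that performs `E` and applies `f` to the outcome. -/
def map (E : POVM Q O) (f : O → R) : POVM Q R where
  elem r := E.effect fun o => f o = r
  psd _ := Matrix.nonneg_iff_posSemidef.1 (E.effect_nonneg _)
  sum_elem := by
    classical
    rw [← E.sum_elem, ← Finset.sum_fiberwise Finset.univ f]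
    unfold effect
    congr!

theorem effect_map (E : POVM Q O) (f : O → R) (p : R → Prop) :
    (E.map f).effect p = E.effect fun o => p (f o) := by
  classical
  have h := Finset.sum_fiberwise_eq_sum_filter Finset.univ (Finset.univ.filter p) f E.elem
  simp only [Finset.mem_filter_univ] at h
  unfold effect map effect
  convert h

theorem effect_prod (E : POVM Q O) (F : POVM Q' O') (p : O × O' → Prop) :
    (E.prod F).effect p = ∑ a, E.elem a ⊗ₖ F.effect fun b => p (a, b) := by
  classical
  ext u v
  simp [effect, prod, Matrix.sum_apply, Finset.sum_filter, Fintype.sum_prod_type, Finset.mul_sum,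
    Matrix.ite_apply, mul_ite]

theorem effect_prod_map (E : POVM Q O) (F : POVM Q' O') (f : O' → R) (p : O × R → Prop) :
    (E.prod (F.map f)).effect p = (E.prod F).effect fun o => p (o.1, f o.2) := by
  simp only [effect_prod, effect_map]

theorem effect_pi {k : ℕ} (E : Fin k → POVM Q O) (p : Fin k → O → Prop) :
    (pi E).effect (fun o => ∀ i, p i (o i)) = tensorAll fun i => (E i).effect (p i) := by
  classical
  simp only [effect, Finset.sum_filter, ← tensorAll_sum, pi]
  refine Finset.sum_congr rfl fun o _ => ?_
  split_ifs with h
  · simp only [h, if_true]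
  · obtain ⟨i, hi⟩ := not_forall.1 h
    exact (tensorAll_eq_zero (if_neg hi)).symm

end POVM

namespace CQState

variable {Q T : Type} [Fintype Q] [Fintype T]

open scoped Classical in
/-- The quantum state `σ` together with the fixed classical value `t`. -/
def ofClassical (σ : DensityOp Q) (t : T) : CQState Q T where
  op := Pi.single t σ.op
  psd := by
    intro t'
    obtain rfl | h := eq_or_ne t' t
    · simpa using σ.psd
    · simpa [h] using Matrix.PosSemidef.zero
  trace_op := by
    rw [Fintype.sum_eq_single t fun t' h => by simp [h], Pi.single_eq_same, σ.trace_op]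

/-- The product of `k` independent classical-quantum states. -/
def pi {k : ℕ} (ρ : Fin k → CQState Q T) : CQState (Fin k → Q) (Fin k → T) where
  op t := tensorAll fun i => (ρ i).op (t i)
  psd t := tensorAll_psd fun i => (ρ i).psd (t i)
  trace_op := by
    simp only [tensorAll_trace]
    rw [← Fintype.prod_sum fun i t => ((ρ i).op t).trace]
    simp [CQState.trace_op]

end CQState

namespace OneMessageProof

variable {W Q T C O : Type} [Fintype Q] [DecidableEq Q] [Fintype T] [Fintype C] [Fintype O]

/-- The operator on the quantum message of the event that the verifier accepts when the classical
message is `t`, averaged over the verifier's coins. -/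
def acceptOp (P : OneMessageProof W Q T C O) (t : T) : Matrix Q Q ℂ :=
  (Fintype.card C : ℝ)⁻¹ • ∑ c, (P.meas c).effect fun o => P.decision c o t

theorem acceptOp_nonneg (P : OneMessageProof W Q T C O) (t : T) : 0 ≤ P.acceptOp t :=
  smul_nonneg (by positivity) (Finset.sum_nonneg fun _ _ => POVM.effect_nonneg _ _)

theorem acceptProb_eq_sum_trace (P : OneMessageProof W Q T C O) (ρ : CQState Q T) :
    P.acceptProb ρ = ∑ t, (ρ.op t * P.acceptOp t).trace.re := by
  classical
  rw [acceptProb, Finset.sum_comm, Finset.mul_sum]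
  refine Finset.sum_congr rfl fun t _ => ?_
  rw [acceptOp, Matrix.mul_smul, Matrix.trace_smul, Complex.smul_re, Matrix.mul_sum,
    Matrix.trace_sum, Complex.re_sum, smul_eq_mul]
  simp only [POVM.trace_mul_effect_re]

theorem acceptProb_ofClassical (P : OneMessageProof W Q T C O) (σ : DensityOp Q) (t : T) :
    P.acceptProb (CQState.ofClassical σ t) = (σ.op * P.acceptOp t).trace.re := by
  rw [acceptProb_eq_sum_trace, Fintype.sum_eq_single t fun t' h => by simp [CQState.ofClassical, h]]
  simp [CQState.ofClassical]

theorem acceptOp_le_smul_one_iff (P : OneMessageProof W Q T C O) {t : T} {ε : ℝ} :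
    P.acceptOp t ≤ ε • 1 ↔ ∀ σ, P.acceptProb (CQState.ofClassical σ t) ≤ ε := by
  have hHerm := (Matrix.nonneg_iff_posSemidef.1 (P.acceptOp_nonneg t)).isHermitian
  simp only [le_smul_one_iff_forall_trace_le hHerm, acceptProb_ofClassical]

theorem forall_acceptProb_le_iff (P : OneMessageProof W Q T C O) {ε : ℝ} :
    (∀ ρ, P.acceptProb ρ ≤ ε) ↔ ∀ t, P.acceptOp t ≤ ε • 1 := by
  constructor
  · exact fun h t => P.acceptOp_le_smul_one_iff.2 fun σ => h _
  · intro h ρ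
    calc
      P.acceptProb ρ = ∑ t, (ρ.op t * P.acceptOp t).trace.re := P.acceptProb_eq_sum_trace ρ
      _ ≤ ∑ t, (ρ.op t * ε • 1).trace.re := Finset.sum_le_sum fun t _ =>
        (Complex.le_def.1 <|
          trace_mul_le_trace_mul (Matrix.nonneg_iff_posSemidef.2 (ρ.psd t)) (h t)).1
      _ = (ε • ∑ t, (ρ.op t).trace).re := by simp [Finset.mul_sum]
      _ = ε := by simp [ρ.trace_op]

/-- The `k`-fold parallel repetition of `P`: the copies are independent on the honest side, and the
verifier accepts iff all copies accept. -/
def parallel (P : OneMessageProof W Q T C O) (k : ℕ) :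
    OneMessageProof W (Fin k → Q) (Fin k → T) (Fin k → C) (Fin k → O) where
  honest w := CQState.pi fun _ => P.honest w
  meas c := POVM.pi fun i => P.meas (c i)
  decision c o t := ∀ i, P.decision (c i) (o i) (t i)

theorem acceptOp_parallel (P : OneMessageProof W Q T C O) (k : ℕ) (t : Fin k → T) :
    (P.parallel k).acceptOp t = tensorAll fun i => P.acceptOp (t i) := by
  classical
  simp only [acceptOp, parallel]
  rw [tensorAll_smul, ← tensorAll_sum fun i c => (P.meas c).effect fun o => P.decision c o (t i)]
  simp [← POVM.effect_pi]

theorem IsSound.parallel {W Q T C O : List Bool → Type} [∀ x, Fintype (Q x)]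
    [∀ x, DecidableEq (Q x)] [∀ x, Fintype (T x)] [∀ x, Fintype (C x)] [∀ x, Fintype (O x)]
    {P : ∀ x, OneMessageProof (W x) (Q x) (T x) (C x) (O x)} {L : Language Bool} {ε : ℝ}
    (hP : IsSound P L ε) (k : ℕ) : IsSound (fun x => (P x).parallel k) L (ε ^ k) := by
  intro x hx
  have hle := (P x).forall_acceptProb_le_iff.1 (hP x hx)
  refine ((P x).parallel k).forall_acceptProb_le_iff.2 fun t => ?_
  rw [acceptOp_parallel]
  exact tensorAll_le_pow_smul_one (fun i => (P x).acceptOp_nonneg (t i)) fun i => hle (t i)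

end OneMessageProof

namespace XiProtocol

theorem acceptProb_eq_sum_trace (P : XiProtocol) (x : List Bool)
    (S : InteractiveProver (Bits (P.msgQubits x)) (Bits (P.respLen x))) :
    P.acceptProb x S = 1 / 2 * ∑ c, (S.state.op *
      ((P.meas x c).prod (S.respond c)).effect fun o => P.pred x o.1 c o.2).trace.re := by
  simp only [acceptProb, POVM.trace_mul_effect_re, Fintype.sum_prod_type, POVM.prod]

variable (P : XiProtocol) {n : ℕ} (x : List Bool) (H : UniversalHash n (P.respLen x))

/-- One copy of the compiled protocol on instance `x`, as a one-message proof of its own. -/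
def NIPCopy : OneMessageProof (P.Witness x) (Bits (P.msgQubits x) × Bits n) (OTMsg H) Bool
    (Bits (P.outLen x) × Bits n) where
  honest w :=
    { op := P.copyState x H w
      psd := P.copyState_psd x H w
      trace_op := P.copyState_trace x H w }
  meas c := (P.meas x c).prod (bb84Meas fun _ => c)
  decision c o t := P.pred x o.1 c (otOutput H t c o.2)

/-- The interactive prover that keeps the register `X` of a message `(σ, t)` for one copy of the
compiled protocol and, on challenge `c`, does to it what the verifier of that copy would do. -/
def copyProver (t : OTMsg H) (σ : DensityOp (Bits (P.msgQubits x) × Bits n)) :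
    InteractiveProver (Bits (P.msgQubits x)) (Bits (P.respLen x)) where
  B := Bits n
  state := σ
  respond c := (bb84Meas fun _ => c).map (otOutput H t c)

theorem acceptProb_copyProver (t : OTMsg H) (σ : DensityOp (Bits (P.msgQubits x) × Bits n)) :
    P.acceptProb x (P.copyProver x H t σ) =
      (P.NIPCopy x H).acceptProb (CQState.ofClassical σ t) := by
  have hchallenge (c : Bool) :
      ((P.copyProver x H t σ).state.op * ((P.meas x c).prod
        ((P.copyProver x H t σ).respond c)).effect fun o => P.pred x o.1 c o.2).trace.re =
      (σ.op * ((P.NIPCopy x H).meas c).effect fun o =>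
        (P.NIPCopy x H).decision c o t).trace.re :=
    congrArg (fun M => (σ.op * M).trace.re) (POVM.effect_prod_map _ _ _ _)
  simp only [OneMessageProof.acceptProb_ofClassical, acceptProb_eq_sum_trace, hchallenge,
    OneMessageProof.acceptOp, Matrix.mul_smul, Matrix.mul_sum, Matrix.trace_smul, Matrix.trace_sum,
    Complex.smul_re, Complex.re_sum]
  simp

variable {P}

theorem IsSound.nipCopy {L : Language Bool} {ε : ℝ} (hP : P.IsSound L ε)
    (H : ∀ x, UniversalHash n (P.respLen x)) :
    OneMessageProof.IsSound (fun x => P.NIPCopy x (H x)) L ε := by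
  intro x hx
  refine (P.NIPCopy x (H x)).forall_acceptProb_le_iff.2 fun t => ?_
  rw [OneMessageProof.acceptOp_le_smul_one_iff]
  exact fun σ => (P.acceptProb_copyProver x (H x) t σ).symm.trans_le (hP x hx _)

end XiProtocol

end

theorem mainTheorem1_general (P : XiProtocol) (L : Language Bool) {ε : ℝ} (hP : P.IsSound L ε)
    (n : ℕ) (H : ∀ x, UniversalHash n (P.respLen x)) (k : ℕ) :
    OneMessageProof.IsSound (P.NIP H k) L (ε ^ k) :=
  (hP.nipCopy H).parallel k

theorem mainTheorem1 (P : XiProtocol) (L : Language Bool) (hP : P.IsSound L (1 / 2))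
    (n : ℕ) (H : ∀ x, UniversalHash n (P.respLen x)) (k : ℕ) :
    OneMessageProof.IsSound (P.NIP H k) L (1 / 2 ^ k) :=
  one_div_pow (2 : ℝ) k ▸ mainTheorem1_general P L hP n H k
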